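/- Let $X$ be a standard Borel space and $\mu$ a (not necessarily finite or $\sigma$-finite) measure on its Borel $\sigma$-algebra. A map $f : X \to X$ *preserves the measure class* of $\mu$ if for every Borel set $B \subseteq X$ the image $f(B)$ is $\mu$-measurable (i.e. measurable with respect to the completion of $\mu$), and $\mu(f(B)) = 0$ if and only if $\mu(B) = 0$. Let $G$ be an abstract group with identity $e$. * A *measure class preserving near-action* of $G$ on $(X,\mu)$ is a map $\eta : G \times X \to X$ such that $\eta(e,x) = x$ for $\mu$-almost all $x$; for all $g,h \in G$, $\eta(gh,x) = \eta(g,\eta(h,x))$ for $\mu$-almost all $x$; and for every $g \in G$ the map $\eta(g,\cdot)$ preserves the measure class of $\mu$. * A *measure class preserving spatial action* of $G$ on $(X,\mu)$ is a group action $\rho : G \times X \to X$ in the usual sense such that every $\rho(g,\cdot)$ preserves the measure class of $\mu$. It *acts by Borel automorphisms* if every $\rho(g,\cdot)$ is a Borel bijection of $X$ with Borel inverse. * A *spatial model* of a near-action $\eta$ is a measure class preserving spatial action $\rho$ such that for every $g \in G$, $\eta(g,x) = \rho(g,x)$ for $\mu$-almost all $x$. **Corollary.** Suppose that $\mu$ has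 at least one uncountable null set (this holds, for example, whenever $X$ is uncountable and $\mu$ is $\sigma$-finite; the null set can then be chosen to be Borel). If $G$ is a group of cardinality at most $\aleph_1$, then every measure class preserving near-action of $G$ on $(X,\mu)$ has a spatial model acting by Borel automorphisms. In particular, if the Continuum Hypothesis $2^{\aleph_0} = \aleph_1$ holds, then, for every group $G$ of any cardinality, every measure class preserving near-action of $G$ on $(X,\mu)$ has a spatial model acting by Borel automorphisms. -/

import Mathlib

open MeasureTheory

universe u v

/-- `f` preserves the measure class of `μ`: the image of every Borel set is `μ`-measurable
(measurable for the completion of `μ`), and it is null exactly when the set is null. -/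
def PreservesMeasureClass {X : Type*} [MeasurableSpace X] (μ : Measure X) (f : X → X) : Prop :=
  ∀ B : Set X, MeasurableSet B →
    NullMeasurableSet (f '' B) μ ∧ (μ (f '' B) = 0 ↔ μ B = 0)

/-- `η : G × X → X` (curried) is a measure class preserving near-action of `G` on `(X, μ)`. -/
structure IsNearAction {G X : Type*} [Group G] [MeasurableSpace X] (μ : Measure X)
    (η : G → X → X) : Prop where
  one_ae : ∀ᵐ x ∂μ, η 1 x = x
  mul_ae : ∀ g h : G, ∀ᵐ x ∂μ, η (g * h) x = η g (η h x)
  preserves : ∀ g : G, PreservesMeasureClass μ (η g)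

/-- `ρ : G × X → X` (curried) is a measure class preserving spatial action of `G` on `(X, μ)`:
an action in the usual sense that preserves the measure class. -/
structure IsSpatialAction {G X : Type*} [Group G] [MeasurableSpace X] (μ : Measure X)
    (ρ : G → X → X) : Prop where
  one : ∀ x, ρ 1 x = x
  mul : ∀ (g h : G) (x : X), ρ (g * h) x = ρ g (ρ h x)
  preserves : ∀ g : G, PreservesMeasureClass μ (ρ g)

/-- Every `ρ g` is a Borel automorphism of `X`, a Borel bijection with Borel inverse. -/
def ActsByBorelAutomorphisms {G X : Type*} [MeasurableSpace X] (ρ : G → X → X) : Prop :=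
  ∀ g : G, ∃ e : X ≃ᵐ X, ∀ x, e x = ρ g x

/-- `ρ` is a spatial model of the near-action `η`: a spatial action such that, for each `g`,
`η g` and `ρ g` agree almost everywhere. -/
structure IsSpatialModel {G X : Type*} [Group G] [MeasurableSpace X] (μ : Measure X)
    (η ρ : G → X → X) : Prop where
  isSpatialAction : IsSpatialAction μ ρ
  ae_eq : ∀ g : G, ∀ᵐ x ∂μ, η g x = ρ g x

/-!
Modulo the elements acting trivially almost everywhere, `G` embeds in the Borel maps of `X` modulo
`μ`, so it has at most continuum many elements, and under the Continuum Hypothesis at most `ℵ₁`. A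
group of cardinality at most `ℵ₁` has a linear order with countable initial segments, and a model is
built by transfinite recursion along the countable subgroups these segments generate.

Extending a Borel model from a countable `H` to a countable `K > H` is easy on a conull set, where
Borel representatives of the near-action form an action of `K`. On the null remainder `A` an
arbitrary Borel action of `H` has to be extended to `K`. Such an extension exists when `A` is
`H`-equivariantly Borel isomorphic to a set with an action of `K`. By the equivariant
Cantor–Bernstein argument it is enough that each embeds `H`-equivariantly in the other. The set with
a `K`-action is the space of maps from `K` to `X`, into which `A` embeds by orbit maps. That it
embeds in `A` is arranged in advance: the uncountable null set contains a Borel copy of a space of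
slots, on which every model constructed is prescribed. A slot carries a coding of a countable group
by self-maps of `ℕ`, and the slots coding `K` are still free at stage `H`, so their copy of the maps
from `K` to `X` is available in `A` when the action of `H` is extended to `K`.
-/

open Set Filter

section BorelActions

variable {G X Y : Type*} [Group G] {K : Subgroup G}

/-- `a` restricts to an action of the subgroup `K` on the set `A` by measurable maps. Each `a k` is
a total map and `a` is defined on all of `G`; values outside `A` or `K` are irrelevant. -/
structure IsBorelActionOn [MeasurableSpace Y] (K : Subgroup G) (a : G → Y → Y) (A : Set Y) :
    Prop where
  measurable : ∀ k ∈ K, Measurable (a k)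
  mapsTo : ∀ k ∈ K, MapsTo (a k) A A
  one : ∀ x ∈ A, a 1 x = x
  mul : ∀ k ∈ K, ∀ l ∈ K, ∀ x ∈ A, a (k * l) x = a k (a l x)

namespace IsBorelActionOn

variable [MeasurableSpace X] [MeasurableSpace Y] {a b : G → Y → Y} {A B : Set Y}

theorem inv_apply (h : IsBorelActionOn K a A) {k : G} (hk : k ∈ K) {x : Y} (hx : x ∈ A) :
    a k⁻¹ (a k x) = x := by
  rw [← h.mul k⁻¹ (K.inv_mem hk) k hk x hx, inv_mul_cancel, h.one x hx]

theorem apply_inv (h : IsBorelActionOn K a A) {k : G} (hk : k ∈ K) {x : Y} (hx : x ∈ A) :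
    a k (a k⁻¹ x) = x := by
  simpa using h.inv_apply (K.inv_mem hk) hx

theorem apply_mem_iff (h : IsBorelActionOn K a A) (hB : ∀ k ∈ K, ∀ x ∈ B, a k x ∈ B)
    {k : G} (hk : k ∈ K) {x : Y} (hx : x ∈ A) : a k x ∈ B ↔ x ∈ B :=
  ⟨fun hkx ↦ h.inv_apply hk hx ▸ hB _ (K.inv_mem hk) _ hkx, hB k hk x⟩

theorem mono (h : IsBorelActionOn K a A) {J : Subgroup G} (hJ : J ≤ K) (hBA : B ⊆ A)
    (hB : ∀ k ∈ J, MapsTo (a k) B B) : IsBorelActionOn J a B where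
  measurable k hk := h.measurable k (hJ hk)
  mapsTo := hB
  one x hx := h.one x (hBA hx)
  mul k hk l hl x hx := h.mul k (hJ hk) l (hJ hl) x (hBA hx)

theorem diff (h : IsBorelActionOn K a A) (hB : ∀ k ∈ K, MapsTo (a k) B B) :
    IsBorelActionOn K a (A \ B) :=
  h.mono le_rfl sdiff_subset fun k hk _x hx ↦
    ⟨h.mapsTo k hk hx.1, fun hkx ↦ hx.2 ((h.apply_mem_iff hB hk hx.1).1 hkx)⟩

theorem congr (h : IsBorelActionOn K a A) (hab : ∀ k ∈ K, b k = a k) :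
    IsBorelActionOn K b A where
  measurable k hk := hab k hk ▸ h.measurable k hk
  mapsTo k hk := hab k hk ▸ h.mapsTo k hk
  one x hx := by rw [hab 1 K.one_mem, h.one x hx]
  mul k hk l hl x hx := by
    rw [hab _ (K.mul_mem hk hl), hab k hk, hab l hl, h.mul k hk l hl x hx]

theorem conj {b : G → X → X} {B : Set X} (h : IsBorelActionOn K b B) {ψ : Y → X} {θ : X → Y}
    (hψ : Measurable ψ) (hθ : Measurable θ) (hψA : MapsTo ψ A B) (hθB : MapsTo θ B A)
    (hinv : InvOn θ ψ A B) : IsBorelActionOn K (fun k ↦ θ ∘ b k ∘ ψ) A where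
  measurable k hk := hθ.comp ((h.measurable k hk).comp hψ)
  mapsTo k hk := hθB.comp ((h.mapsTo k hk).comp hψA)
  one x hx := by
    simp only [Function.comp_apply, h.one _ (hψA hx), hinv.1 hx]
  mul k hk l hl x hx := by
    simp only [Function.comp_apply, h.mul k hk l hl _ (hψA hx),
      hinv.2 (h.mapsTo l hl (hψA hx))]

open scoped Classical in
theorem piecewise (ha : IsBorelActionOn K a A) (hb : IsBorelActionOn K b B)
    (hA : MeasurableSet A) (hAB : Disjoint A B) :
    IsBorelActionOn K (fun k ↦ A.piecewise (a k) (b k)) (A ∪ B) where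
  measurable k hk := (ha.measurable k hk).piecewise hA (hb.measurable k hk)
  mapsTo k hk x hx := by
    by_cases hxA : x ∈ A
    · exact .inl (by simpa only [piecewise_eq_of_mem A _ _ hxA] using ha.mapsTo k hk hxA)
    · have hkx := hb.mapsTo k hk (hx.resolve_left hxA)
      exact .inr (by simpa only [piecewise_eq_of_notMem A _ _ hxA] using hkx)
  one x hx := by
    by_cases hxA : x ∈ A
    · simp only [piecewise_eq_of_mem A _ _ hxA, ha.one x hxA]
    · simp only [piecewise_eq_of_notMem A _ _ hxA, hb.one x (hx.resolve_left hxA)]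
  mul k hk l hl x hx := by
    by_cases hxA : x ∈ A
    · rw [piecewise_eq_of_mem A _ _ hxA, piecewise_eq_of_mem A _ _ hxA,
        piecewise_eq_of_mem A _ _ (ha.mapsTo l hl hxA), ha.mul k hk l hl x hxA]
    · have hxB := hx.resolve_left hxA
      have hlx : b l x ∉ A := hAB.notMem_of_mem_right (hb.mapsTo l hl hxB)
      rw [piecewise_eq_of_notMem A _ _ hxA, piecewise_eq_of_notMem A _ _ hxA,
        piecewise_eq_of_notMem A _ _ hlx, hb.mul k hk l hl x hxB]

end IsBorelActionOn

/-- The largest set avoiding `N` on which the maps `F k`, `k ∈ K`, form an action. -/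
def actionLocus (K : Subgroup G) (F : G → Y → Y) (N : Set Y) : Set Y :=
  {x | F 1 x = x ∧ (∀ k ∈ K, ∀ l ∈ K, F (k * l) x = F k (F l x)) ∧ ∀ k ∈ K, F k x ∉ N}

theorem apply_mem_actionLocus {F : G → Y → Y} {N : Set Y} {k : G} (hk : k ∈ K) {x : Y}
    (hx : x ∈ actionLocus K F N) : F k x ∈ actionLocus K F N := by
  obtain ⟨-, hmul, hN⟩ := hx
  refine ⟨?_, fun l hl m hm ↦ ?_, fun l hl ↦ ?_⟩
  · rw [← hmul 1 K.one_mem k hk, one_mul]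
  · rw [← hmul _ (K.mul_mem hl hm) k hk, mul_assoc, hmul l hl _ (K.mul_mem hm hk), hmul m hm k hk]
  · rw [← hmul l hl k hk]
    exact hN _ (K.mul_mem hl hk)

theorem isBorelActionOn_actionLocus [MeasurableSpace Y] {F : G → Y → Y}
    (hF : ∀ k ∈ K, Measurable (F k)) (N : Set Y) :
    IsBorelActionOn K F (actionLocus K F N) where
  measurable := hF
  mapsTo _k hk _x hx := apply_mem_actionLocus hk hx
  one _x hx := hx.1
  mul k hk l hl _x hx := hx.2.1 k hk l hl

theorem measurableSet_actionLocus [MeasurableSpace Y] [MeasurableEq Y] [Countable K] {F : G → Y → Y}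
    (hF : ∀ k ∈ K, Measurable (F k)) {N : Set Y} (hN : MeasurableSet N) :
    MeasurableSet (actionLocus K F N) := by
  have hK : (K : Set G).Countable := to_countable _
  simp only [actionLocus, ofPred_and, ofPred_forall]
  refine .inter (measurableSet_eq_fun (hF 1 K.one_mem) measurable_id) (.inter ?_ ?_)
  · exact .biInter hK fun k hk ↦ .biInter hK fun l hl ↦
      measurableSet_eq_fun (hF _ (K.mul_mem hk hl)) ((hF k hk).comp (hF l hl))
  · exact .biInter hK fun k hk ↦ (hF k hk hN).compl

theorem actionLocus_anti {J K : Subgroup G} (hJK : J ≤ K) {F : G → Y → Y} {M N : Set Y}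
    (hMN : M ⊆ N) : actionLocus K F N ⊆ actionLocus J F M := fun _x hx ↦
  ⟨hx.1, fun k hk l hl ↦ hx.2.1 k (hJK hk) l (hJK hl), fun k hk hkx ↦ hx.2.2 k (hJK hk) (hMN hkx)⟩

theorem disjoint_actionLocus (K : Subgroup G) (F : G → Y → Y) (N : Set Y) :
    Disjoint (actionLocus K F N) N :=
  disjoint_left.2 fun _x hx hxN ↦ hx.2.2 1 K.one_mem (hx.1.symm ▸ hxN)

end BorelActions

section CantorBernstein

/-- The points of `A` reached from `A \ g '' B` by iterating `g ∘ f`. On this set the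
Cantor–Bernstein bijection between `A` and `B` is `f`, off it the inverse of `g`. -/
def cantorBernsteinSet {X E : Type*} (f : X → E) (g : E → X) (A : Set X) (B : Set E) : Set X :=
  ⋃ n, (g ∘ f)^[n] '' (A \ g '' B)

section Set

variable {X E : Type*} {f : X → E} {g : E → X} {A : Set X} {B : Set E}

theorem mem_image_of_mem_diff_cantorBernsteinSet {x : X} (hx : x ∈ A)
    (hxS : x ∉ cantorBernsteinSet f g A B) : x ∈ g '' B := by
  by_contra hxB
  exact hxS (mem_iUnion.2 ⟨0, x, ⟨hx, hxB⟩, rfl⟩)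

theorem cantorBernsteinSet_subset (hf : MapsTo f A B) (hg : MapsTo g B A) :
    cantorBernsteinSet f g A B ⊆ A :=
  iUnion_subset fun n ↦ image_subset_iff.2 fun _x hx ↦ (hg.comp hf).iterate n hx.1

theorem apply_mem_cantorBernsteinSet_iff (hg : g.Injective) {y : E} (hy : y ∈ B) :
    g y ∈ cantorBernsteinSet f g A B ↔ y ∈ f '' cantorBernsteinSet f g A B := by
  constructor
  · intro h
    obtain ⟨n, x, hx, hxy⟩ := mem_iUnion.1 h
    cases n with
    | zero => exact absurd (mem_image_of_mem g hy) (hxy ▸ hx.2)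
    | succ n =>
      rw [Function.iterate_succ_apply'] at hxy
      exact ⟨_, mem_iUnion.2 ⟨n, x, hx, rfl⟩, hg hxy⟩
  · rintro ⟨z, hz, rfl⟩
    obtain ⟨n, x, hx, rfl⟩ := mem_iUnion.1 hz
    exact mem_iUnion.2 ⟨n + 1, x, hx, Function.iterate_succ_apply' _ _ _⟩

theorem mapsTo_cantorBernsteinSet {s : X → X} (hs : MapsTo s (A \ g '' B) (A \ g '' B))
    (hf : MapsTo f A B) (hg : MapsTo g B A) (hgf : ∀ x ∈ A, s (g (f x)) = g (f (s x))) :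
    MapsTo s (cantorBernsteinSet f g A B) (cantorBernsteinSet f g A B) := by
  have hiter (n : ℕ) : ∀ x ∈ A, s ((g ∘ f)^[n] x) = (g ∘ f)^[n] (s x) := by
    induction n with
    | zero => exact fun _ _ ↦ rfl
    | succ n ih =>
      intro x hx
      rw [Function.iterate_succ_apply, Function.comp_apply, ih _ (hg (hf hx)), hgf x hx,
        Function.iterate_succ_apply, Function.comp_apply]
  rintro _ ⟨_, ⟨n, rfl⟩, x, hx, rfl⟩
  exact mem_iUnion.2 ⟨n, s x, hs hx, (hiter n x hx.1).symm⟩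

theorem measurableSet_cantorBernsteinSet [MeasurableSpace X] [MeasurableSpace E]
    (hf : MeasurableEmbedding f) (hg : MeasurableEmbedding g) (hA : MeasurableSet A)
    (hB : MeasurableSet B) : MeasurableSet (cantorBernsteinSet f g A B) := by
  refine .iUnion fun n ↦ ?_
  induction n with
  | zero => simpa using hA.diff (hg.measurableSet_image' hB)
  | succ n ih =>
    rw [Function.iterate_succ', image_comp]
    exact (hg.comp hf).measurableSet_image' ih

theorem invOn_of_eqOn_cantorBernsteinSet {ψ : X → E} {θ : E → X} (hf : MapsTo f A B)
    (hg : g.Injective) (hgB : MapsTo g B A) (hψf : EqOn ψ f (cantorBernsteinSet f g A B))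
    (hψg : ∀ y ∈ B, g y ∉ cantorBernsteinSet f g A B → ψ (g y) = y)
    (hθf : ∀ x ∈ cantorBernsteinSet f g A B, θ (f x) = x)
    (hθg : ∀ y ∈ B, g y ∉ cantorBernsteinSet f g A B → θ y = g y) :
    MapsTo ψ A B ∧ MapsTo θ B A ∧ InvOn θ ψ A B := by
  set S := cantorBernsteinSet f g A B
  have hA {x : X} (hx : x ∈ A) : ψ x ∈ B ∧ θ (ψ x) = x := by
    by_cases hxS : x ∈ S
    · rw [hψf hxS]
      exact ⟨hf hx, hθf x hxS⟩
    · obtain ⟨y, hy, rfl⟩ := mem_image_of_mem_diff_cantorBernsteinSet hx hxS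
      rw [hψg y hy hxS]
      exact ⟨hy, hθg y hy hxS⟩
  have hB {y : E} (hy : y ∈ B) : θ y ∈ A ∧ ψ (θ y) = y := by
    by_cases hyS : g y ∈ S
    · obtain ⟨x, hx, rfl⟩ := (apply_mem_cantorBernsteinSet_iff hg hy).1 hyS
      rw [hθf x hx]
      exact ⟨cantorBernsteinSet_subset hf hgB hx, hψf hx⟩
    · rw [hθg y hy hyS]
      exact ⟨hgB hy, hψg y hy hyS⟩
  exact ⟨fun x hx ↦ (hA hx).1, fun y hy ↦ (hB hy).1, fun x hx ↦ (hA hx).2, fun y hy ↦ (hB hy).2⟩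

open scoped Classical in
theorem exists_measurable_invOn [MeasurableSpace X] [MeasurableSpace E]
    (hf : MeasurableEmbedding f) (hfA : MapsTo f A B) (hA : MeasurableSet A)
    (hg : MeasurableEmbedding g) (hgB : MapsTo g B A) (hB : MeasurableSet B) :
    ∃ (ψ : X → E) (θ : E → X), Measurable ψ ∧ Measurable θ ∧
      (MapsTo ψ A B ∧ MapsTo θ B A ∧ InvOn θ ψ A B) ∧ EqOn ψ f (cantorBernsteinSet f g A B) ∧
      ∀ y ∈ B, g y ∉ cantorBernsteinSet f g A B → ψ (g y) = y := by
  set S := cantorBernsteinSet f g A B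
  have hS : MeasurableSet S := measurableSet_cantorBernsteinSet hf hg hA hB
  obtain ⟨f', hf', hff'⟩ := hf.exists_measurable_extend measurable_id fun y ↦ ⟨g y⟩
  obtain ⟨g', hg', hgg'⟩ := hg.exists_measurable_extend measurable_id fun x ↦ ⟨f x⟩
  have hψf : EqOn (S.piecewise f g') f S := piecewise_eqOn S f g'
  have hψg : ∀ y ∈ B, g y ∉ S → S.piecewise f g' (g y) = y := fun y _ hyS ↦
    (piecewise_eq_of_notMem _ _ _ hyS).trans (congrFun hgg' y)
  refine ⟨S.piecewise f g', (g ⁻¹' S).piecewise f' g, hf.measurable.piecewise hS hg',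
    hf'.piecewise (hg.measurable hS) hg.measurable, ?_, hψf, hψg⟩
  refine invOn_of_eqOn_cantorBernsteinSet hfA hg.injective hgB hψf hψg (fun x hx ↦ ?_)
    fun y _ hyS ↦ piecewise_eq_of_notMem _ _ _ hyS
  have hgfx : g (f x) ∈ S :=
    (apply_mem_cantorBernsteinSet_iff hg.injective (hfA (cantorBernsteinSet_subset hfA hgB hx))).2
      ⟨x, hx, rfl⟩
  exact (piecewise_eq_of_mem (g ⁻¹' S) _ _ hgfx).trans (congrFun hff' x)

end Set

section Equivariant

variable {G X E : Type*} [Group G] [MeasurableSpace X] [MeasurableSpace E] {H K : Subgroup G}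
  {σ : G → X → X} {b : G → E → E} {A : Set X} {B : Set E} {f : X → E} {g : E → X}

theorem IsBorelActionOn.mapsTo_cantorBernsteinSet (hσ : IsBorelActionOn H σ A)
    (hb : IsBorelActionOn H b B) (hf : MapsTo f A B) (hg : MapsTo g B A)
    (hfσ : ∀ h ∈ H, ∀ x ∈ A, f (σ h x) = b h (f x))
    (hgb : ∀ h ∈ H, ∀ y ∈ B, g (b h y) = σ h (g y)) {h : G} (hh : h ∈ H) :
    MapsTo (σ h) (cantorBernsteinSet f g A B) (cantorBernsteinSet f g A B) := by
  have hgB : ∀ k ∈ H, MapsTo (σ k) (g '' B) (g '' B) := fun k hk ↦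
    mapsTo_image_iff.2 fun y hy ↦ ⟨b k y, hb.mapsTo k hk hy, hgb k hk y hy⟩
  refine _root_.mapsTo_cantorBernsteinSet ((hσ.diff hgB).mapsTo h hh) hf hg fun x hx ↦ ?_
  rw [hfσ h hh x hx, hgb h hh _ (hf hx)]

theorem exists_equivariant_invOn (hσ : IsBorelActionOn H σ A) (hb : IsBorelActionOn H b B)
    (hA : MeasurableSet A) (hB : MeasurableSet B)
    (hf : MeasurableEmbedding f) (hfA : MapsTo f A B)
    (hfσ : ∀ h ∈ H, ∀ x ∈ A, f (σ h x) = b h (f x))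
    (hg : MeasurableEmbedding g) (hgB : MapsTo g B A)
    (hgb : ∀ h ∈ H, ∀ y ∈ B, g (b h y) = σ h (g y)) :
    ∃ (ψ : X → E) (θ : E → X), Measurable ψ ∧ Measurable θ ∧ MapsTo ψ A B ∧ MapsTo θ B A ∧
      InvOn θ ψ A B ∧ ∀ h ∈ H, ∀ x ∈ A, ψ (σ h x) = b h (ψ x) := by
  obtain ⟨ψ, θ, hψ, hθ, ⟨hψA, hθB, hinv⟩, hψf, hψg⟩ :=
    exists_measurable_invOn hf hfA hA hg hgB hB
  refine ⟨ψ, θ, hψ, hθ, hψA, hθB, hinv, fun h hh x hx ↦ ?_⟩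
  have hS := hσ.apply_mem_iff (fun k hk ↦ hσ.mapsTo_cantorBernsteinSet hb hfA hgB hfσ hgb hk) hh hx
  by_cases hxS : x ∈ cantorBernsteinSet f g A B
  · rw [hψf hxS, hψf (hS.2 hxS), hfσ h hh x hx]
  · obtain ⟨y, hy, rfl⟩ := mem_image_of_mem_diff_cantorBernsteinSet hx hxS
    rw [hψg y hy hxS, ← hgb h hh y hy, hψg _ (hb.mapsTo h hh hy) (hgb h hh y hy ▸ mt hS.1 hxS)]

theorem IsBorelActionOn.exists_extension (hσ : IsBorelActionOn H σ A) (hb : IsBorelActionOn K b B)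
    (hHK : H ≤ K) (hA : MeasurableSet A) (hB : MeasurableSet B)
    (hf : MeasurableEmbedding f) (hfA : MapsTo f A B)
    (hfσ : ∀ h ∈ H, ∀ x ∈ A, f (σ h x) = b h (f x))
    (hg : MeasurableEmbedding g) (hgB : MapsTo g B A)
    (hgb : ∀ h ∈ H, ∀ y ∈ B, g (b h y) = σ h (g y)) :
    ∃ a : G → X → X, IsBorelActionOn K a A ∧ ∀ h ∈ H, EqOn (a h) (σ h) A := by
  have hbH : IsBorelActionOn H b B := hb.mono hHK Subset.rfl fun h hh ↦ hb.mapsTo h (hHK hh)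
  obtain ⟨ψ, θ, hψ, hθ, hψA, hθB, hinv, hψσ⟩ :=
    exists_equivariant_invOn hσ hbH hA hB hf hfA hfσ hg hgB hgb
  refine ⟨_, hb.conj hψ hθ hψA hθB hinv, fun h hh x hx ↦ ?_⟩
  simp only [Function.comp_apply, ← hψσ h hh x hx, hinv.1 (hσ.mapsTo h hh hx)]

end Equivariant

end CantorBernstein

section NearActions

section Preserves

variable {X : Type*} [MeasurableSpace X] {μ : Measure X}

theorem PreservesMeasureClass.measure_image_eq_zero {f : X → X} (hf : PreservesMeasureClass μ f)
    {N : Set X} (hN : μ N = 0) : μ (f '' N) = 0 :=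
  measure_mono_null (image_mono (subset_toMeasurable μ N))
    ((hf _ (measurableSet_toMeasurable μ N)).2.2 (by rwa [measure_toMeasurable]))

theorem measure_preimage_eq_zero_of_tendsto_ae {f : X → X} (hf : Tendsto f (ae μ) (ae μ))
    {N : Set X} (hN : μ N = 0) : μ (f ⁻¹' N) = 0 :=
  compl_mem_ae_iff.1 (hf (compl_mem_ae_iff.2 hN))

theorem preservesMeasureClass_of_tendsto_ae {e : X ≃ᵐ X} (he : Tendsto e (ae μ) (ae μ))
    (he_symm : Tendsto e.symm (ae μ) (ae μ)) : PreservesMeasureClass μ e := by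
  intro B hB
  rw [e.image_eq_preimage_symm]
  refine ⟨(e.symm.measurable hB).nullMeasurableSet, fun h ↦ ?_,
    measure_preimage_eq_zero_of_tendsto_ae he_symm⟩
  simpa [← preimage_comp] using measure_preimage_eq_zero_of_tendsto_ae he h

end Preserves

variable {G X : Type*} [Group G] [MeasurableSpace X] {μ : Measure X} {η ρ : G → X → X}

namespace IsNearAction

theorem inv_apply_ae (hη : IsNearAction μ η) (g : G) : ∀ᵐ x ∂μ, η g⁻¹ (η g x) = x := by
  filter_upwards [hη.mul_ae g⁻¹ g, hη.one_ae] with x hmul hone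
  rw [← hmul, inv_mul_cancel, hone]

theorem apply_inv_ae (hη : IsNearAction μ η) (g : G) : ∀ᵐ x ∂μ, η g (η g⁻¹ x) = x := by
  simpa using hη.inv_apply_ae g⁻¹

theorem preimage_ae_eq_image_inv (hη : IsNearAction μ η) (g : G) (B : Set X) :
    η g ⁻¹' B =ᵐ[μ] η g⁻¹ '' B := by
  have hbad : ∀ᵐ x ∂μ, x ∉ η g⁻¹ '' {y | η g (η g⁻¹ y) ≠ y} :=
    measure_eq_zero_iff_ae_notMem.1
      ((hη.preserves g⁻¹).measure_image_eq_zero (hη.apply_inv_ae g))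
  rw [eventuallyEq_set]
  filter_upwards [hη.inv_apply_ae g, hbad] with x hx hxbad
  refine ⟨fun hxB ↦ ⟨η g x, hxB, hx⟩, ?_⟩
  rintro ⟨y, hy, rfl⟩
  have hgy : η g (η g⁻¹ y) = y := by
    by_contra hne
    exact hxbad ⟨y, hne, rfl⟩
  rwa [mem_preimage, hgy]

theorem tendsto_ae (hη : IsNearAction μ η) (g : G) : Tendsto (η g) (ae μ) (ae μ) := by
  intro s hs
  have himage : μ (η g⁻¹ '' sᶜ) = 0 := (hη.preserves g⁻¹).measure_image_eq_zero hs
  rwa [← measure_congr (hη.preimage_ae_eq_image_inv g sᶜ)] at himage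

theorem aemeasurable [StandardBorelSpace X] (hη : IsNearAction μ η) (g : G) :
    AEMeasurable (η g) μ :=
  NullMeasurable.aemeasurable fun B hB ↦
    ((hη.preserves g⁻¹ B hB).1).congr (hη.preimage_ae_eq_image_inv g B).symm

theorem ae_mem_actionLocus (hη : IsNearAction μ η) {K : Subgroup G} [Countable K] {F : G → X → X}
    (hF : ∀ k ∈ K, η k =ᵐ[μ] F k) {N : Set X} (hN : μ N = 0) :
    ∀ᵐ x ∂μ, x ∈ actionLocus K F N := by
  have hK : (K : Set G).Countable := to_countable _
  have hmul : ∀ᵐ x ∂μ, ∀ k ∈ K, ∀ l ∈ K, F (k * l) x = F k (F l x) := by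
    refine (ae_ball_iff hK).2 fun k hk ↦ (ae_ball_iff hK).2 fun l hl ↦ ?_
    filter_upwards [hη.mul_ae k l, hF _ (K.mul_mem hk hl), hF l hl,
      (hη.tendsto_ae l).eventually (hF k hk)] with x hmul hkl hl hk
    rw [← hkl, hmul, hk, hl]
  have hnull : ∀ᵐ x ∂μ, ∀ k ∈ K, F k x ∉ N := by
    refine (ae_ball_iff hK).2 fun k hk ↦ ?_
    filter_upwards [hF k hk, (hη.tendsto_ae k).eventually (measure_eq_zero_iff_ae_notMem.1 hN)]
      with x hkx hN
    rwa [← hkx]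
  filter_upwards [hη.one_ae, hF 1 K.one_mem, hmul, hnull] with x hone hF1 hmul hnull
  exact ⟨hF1.symm.trans hone, hmul, hnull⟩

end IsNearAction

/-- The Borel automorphism given by an element of a group acting by measurable maps. -/
def IsBorelActionOn.measurableEquiv (hρ : IsBorelActionOn (⊤ : Subgroup G) ρ univ) (g : G) :
    X ≃ᵐ X where
  toFun := ρ g
  invFun := ρ g⁻¹
  left_inv _ := hρ.inv_apply trivial trivial
  right_inv _ := hρ.apply_inv trivial trivial
  measurable_toFun := hρ.measurable g trivial
  measurable_invFun := hρ.measurable g⁻¹ trivial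

theorem IsNearAction.isSpatialModel (hη : IsNearAction μ η)
    (hρ : IsBorelActionOn (⊤ : Subgroup G) ρ univ) (hηρ : ∀ g, η g =ᵐ[μ] ρ g) :
    IsSpatialModel μ η ρ where
  isSpatialAction :=
    { one := fun x ↦ hρ.one x trivial
      mul := fun g h x ↦ hρ.mul g trivial h trivial x trivial
      preserves := fun g ↦ preservesMeasureClass_of_tendsto_ae (e := hρ.measurableEquiv g)
        ((hη.tendsto_ae g).congr' (hηρ g)) ((hη.tendsto_ae g⁻¹).congr' (hηρ g⁻¹)) }
  ae_eq := hηρ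

end NearActions

section Slots

/-- A countable family of self-maps of `ℕ` labelled by real numbers: `(r n).2` has the label
`(r n).1`. Real labels let elements of a group of size at most the continuum be coded in a standard
Borel space. -/
abbrev MapCode := ℕ → ℝ × (ℕ → ℕ)

namespace MapCode

theorem exists_index (c : ℝ) (r : MapCode) : ∃ n, (r n).1 = c ∨ ∀ m, (r m).1 ≠ c := by
  by_cases h : ∃ n, (r n).1 = c
  · exact h.imp fun _ ↦ .inl
  · exact ⟨0, .inr (not_exists.1 h)⟩

open scoped Classical in
/-- The first map with label `c` in the family `r`, or `(r 0).2` if no map has this label. -/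
noncomputable def toMap (c : ℝ) (r : MapCode) : ℕ → ℕ :=
  (r (Nat.find (exists_index c r))).2

open scoped Classical in
theorem toMap_eq {c : ℝ} {r : MapCode} {m : ℕ → ℕ} (hc : ∃ n, (r n).1 = c)
    (hm : ∀ n, (r n).1 = c → (r n).2 = m) : toMap c r = m :=
  hm _ ((Nat.find_spec (exists_index c r)).resolve_right fun h ↦ hc.elim h)

open scoped Classical in
theorem measurable_toMap (c : ℝ) : Measurable (toMap c) := by
  have hlabel (n : ℕ) : MeasurableSet {r : MapCode | (r n).1 = c} :=
    measurableSet_eq_fun (measurable_fst.comp (measurable_pi_apply n)) measurable_const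
  have hindex (n : ℕ) : MeasurableSet {r : MapCode | (r n).1 = c ∨ ∀ m, (r m).1 ≠ c} := by
    simp only [ofPred_or, ofPred_forall]
    exact (hlabel n).union (.iInter fun m ↦ (hlabel m).compl)
  exact Measurable.find (fun n ↦ measurable_snd.comp (measurable_pi_apply n)) hindex
    (exists_index c)

end MapCode

/-- The points on which partial actions are freely prescribed: a family of self-maps of `ℕ`
together with a sequence of points, on which the family acts by permuting positions. -/
abbrev Slot (X : Type*) := MapCode × (ℕ → X)

namespace Slot

variable {G X : Type*} [Group G] {e : G → ℝ} {H K : Subgroup G}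

/-- The map of the slot space attached to `g`, where `e` assigns labels to group elements. It
precomposes with the map labelled `g⁻¹`, which turns a left action on positions into a left action
on sequences. -/
noncomputable def act (e : G → ℝ) (g : G) (s : Slot X) : Slot X :=
  (s.1, s.2 ∘ s.1.toMap (e g⁻¹))

/-- The slots on which `H` acts and whose family carries a label outside `H`. On them every partial
model over `H` is prescribed, so they remain available for its extension to larger subgroups. -/
def free (X : Type*) (e : G → ℝ) (H : Subgroup G) : Set (Slot X) :=
  actionLocus H (act e) {s | ∀ n, (s.1 n).1 ∈ e '' H}

theorem measurable_act [MeasurableSpace X] (g : G) : Measurable (act e g : Slot X → Slot X) := by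
  refine measurable_fst.prodMk (measurable_pi_lambda _ fun n ↦ ?_)
  have hindex : Measurable fun s : Slot X ↦ s.1.toMap (e g⁻¹) n :=
    (measurable_pi_apply n).comp ((MapCode.measurable_toMap _).comp measurable_fst)
  exact (measurable_from_prod_countable_left (f := fun p : (ℕ → X) × ℕ ↦ p.1 p.2)
    measurable_pi_apply).comp (measurable_snd.prodMk hindex)

theorem isBorelActionOn_free [MeasurableSpace X] : IsBorelActionOn H (act e) (free X e H) :=
  isBorelActionOn_actionLocus (fun g _ ↦ measurable_act g) _

theorem measurableSet_free [MeasurableSpace X] [StandardBorelSpace X] [Countable H] :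
    MeasurableSet (free X e H) := by
  refine measurableSet_actionLocus (fun g _ ↦ measurable_act g) ?_
  have hH : MeasurableSet (e '' H) := ((to_countable (H : Set G)).image e).measurableSet
  rw [ofPred_forall]
  exact .iInter fun n ↦
    (measurable_fst.comp ((measurable_pi_apply n).comp measurable_fst)) hH

theorem free_anti (h : H ≤ K) : free X e K ⊆ free X e H :=
  actionLocus_anti h fun _s hs n ↦ image_mono h (hs n)

theorem exists_mapCode (he : e.Injective) (K : Subgroup G) [Countable K] :
    ∃ (r : MapCode) (q : ℕ → G), range q = K ∧ (∀ n, (r n).1 = e (q n)) ∧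
      ∀ k ∈ K, ∀ n, q (r.toMap (e k) n) = k * q n := by
  obtain ⟨q, hq⟩ := (to_countable (K : Set G)).exists_eq_range ⟨1, K.one_mem⟩
  have hqK (n : ℕ) : q n ∈ K := SetLike.mem_coe.1 (hq ▸ mem_range_self n)
  have hsurj : ∀ k ∈ K, ∃ n, q n = k := fun k hk ↦ mem_range.1 (hq ▸ SetLike.mem_coe.2 hk)
  choose! i hi using hsurj
  refine ⟨fun n ↦ (e (q n), fun m ↦ i (q n * q m)), q, hq.symm, fun _ ↦ rfl, fun k hk n ↦ ?_⟩
  have hmap : MapCode.toMap (e k) (fun n ↦ (e (q n), fun m ↦ i (q n * q m))) =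
      fun m ↦ i (k * q m) :=
    MapCode.toMap_eq ⟨i k, congrArg e (hi k hk)⟩ fun n hn ↦ by rw [he hn]
  rw [hmap, hi _ (K.mul_mem hk (hqK n))]

/-- The slots with the family `r` on which `K` acts. -/
def fiber (X : Type*) (e : G → ℝ) (K : Subgroup G) (r : MapCode) : Set (Slot X) :=
  {s | s.1 = r} ∩ actionLocus K (act e) ∅

theorem measurableSet_fiber [MeasurableSpace X] [StandardBorelSpace X] [Countable K]
    (r : MapCode) : MeasurableSet (fiber X e K r) :=
  (measurable_fst (measurableSet_singleton r)).inter
    (measurableSet_actionLocus (fun g _ ↦ measurable_act g) .empty)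

theorem isBorelActionOn_fiber [MeasurableSpace X] (r : MapCode) :
    IsBorelActionOn K (act e) (fiber X e K r) :=
  (isBorelActionOn_actionLocus (fun g _ ↦ measurable_act g) ∅).mono le_rfl inter_subset_right
    fun _k hk _s hs ↦ ⟨hs.1, apply_mem_actionLocus hk hs.2⟩

section Label

variable {r : MapCode} {q : ℕ → G}

theorem disjoint_fiber_free (hq : range q = K) (hr : ∀ n, (r n).1 = e (q n)) :
    Disjoint (fiber X e K r) (free X e K) := by
  refine (disjoint_actionLocus K (act e) _).symm.mono_left ?_
  rintro s ⟨rfl, -⟩ n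
  exact ⟨q n, hq ▸ mem_range_self n, (hr n).symm⟩

theorem fiber_subset_free (he : e.Injective) (hq : range q = K) (hr : ∀ n, (r n).1 = e (q n))
    (hHK : H < K) : fiber X e K r ⊆ free X e H := by
  obtain ⟨k, hkK, hkH⟩ := SetLike.exists_of_lt hHK
  obtain ⟨n, rfl⟩ : k ∈ range q := hq ▸ hkK
  rintro s ⟨rfl, hs⟩
  obtain ⟨hone, hmul, -⟩ := actionLocus_anti hHK.le Subset.rfl hs
  refine ⟨hone, hmul, fun h _ hlabels ↦ ?_⟩
  obtain ⟨h', hh', heq⟩ := hlabels n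
  exact hkH (he (heq.trans (hr n)) ▸ hh')

theorem act_mk_comp (hqr : ∀ k ∈ K, ∀ n, q (r.toMap (e k) n) = k * q n) {k : G} (hk : k ∈ K)
    (w : G → X) : act e k (r, w ∘ q) = (r, (fun g ↦ w (k⁻¹ * g)) ∘ q) :=
  Prod.ext rfl (funext fun n ↦ congrArg w (hqr k⁻¹ (K.inv_mem hk) n))

theorem mk_comp_mem_fiber (hqr : ∀ k ∈ K, ∀ n, q (r.toMap (e k) n) = k * q n) (w : G → X) :
    (r, w ∘ q) ∈ fiber X e K r := by
  refine ⟨rfl, ?_, fun k hk l hl ↦ ?_, fun _ _ ↦ notMem_empty _⟩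
  · simp only [act_mk_comp hqr K.one_mem, inv_one, one_mul]
  · simp only [act_mk_comp hqr hl, act_mk_comp hqr hk, act_mk_comp hqr (K.mul_mem hk hl),
      mul_inv_rev, mul_assoc]

open scoped Classical in
/-- The orbit map of an action `σ` of `H`, extended by `x₀` outside `H`, hence a point of the
action of a larger group coinduced from `σ`. At `1` it is `x` also where `σ` is not an action, which
makes it injective in `x`. -/
noncomputable def orbitMap (H : Subgroup G) (σ : G → X → X) (x₀ x : X) (g : G) : X :=
  if g = 1 then x else if g ∈ H then σ g⁻¹ x else x₀

theorem measurable_orbitMap [MeasurableSpace X] {σ : G → X → X}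
    (hσ : ∀ h ∈ H, Measurable (σ h)) (x₀ : X) (g : G) :
    Measurable fun x ↦ orbitMap H σ x₀ x g := by
  unfold orbitMap
  split_ifs with hone hg
  exacts [measurable_id, hσ _ (H.inv_mem hg), measurable_const]

theorem orbitMap_apply [MeasurableSpace X] {σ : G → X → X} {A : Set X}
    (hσ : IsBorelActionOn H σ A) (x₀ : X) {h : G} (hh : h ∈ H) {x : X} (hx : x ∈ A) (g : G) :
    orbitMap H σ x₀ (σ h x) g = orbitMap H σ x₀ x (h⁻¹ * g) := by
  have horbit {y : X} (hy : y ∈ A) {k : G} (hk : k ∈ H) : orbitMap H σ x₀ y k = σ k⁻¹ y := by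
    unfold orbitMap
    split_ifs with hone
    · rw [hone, inv_one, hσ.one y hy]
    · rfl
  have hmem : h⁻¹ * g ∈ H ↔ g ∈ H := H.mul_mem_cancel_left (H.inv_mem hh)
  by_cases hg : g ∈ H
  · rw [horbit (hσ.mapsTo h hh hx) hg, horbit hx (hmem.2 hg), mul_inv_rev, inv_inv,
      hσ.mul _ (H.inv_mem hg) h hh x hx]
  · have hout {y : X} {k : G} (hk : k ∉ H) : orbitMap H σ x₀ y k = x₀ := by
      rw [orbitMap, if_neg (ne_of_mem_of_not_mem H.one_mem hk).symm, if_neg hk]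
    rw [hout hg, hout (mt hmem.1 hg)]

theorem exists_equivariant_mapsTo_fiber [MeasurableSpace X] [StandardBorelSpace X] [Nonempty X]
    (hq : range q = K) (hqr : ∀ k ∈ K, ∀ n, q (r.toMap (e k) n) = k * q n) (hHK : H ≤ K)
    {σ : G → X → X} {A : Set X} (hσ : IsBorelActionOn H σ A) :
    ∃ f : X → Slot X, MeasurableEmbedding f ∧ MapsTo f A (fiber X e K r) ∧
      ∀ h ∈ H, ∀ x ∈ A, f (σ h x) = act e h (f x) := by
  obtain ⟨x₀⟩ := ‹Nonempty X›
  obtain ⟨n, hn⟩ : 1 ∈ range q := hq ▸ K.one_mem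
  have hmeas : Measurable fun x ↦ ((r, orbitMap H σ x₀ x ∘ q) : Slot X) :=
    measurable_const.prodMk
      (measurable_pi_lambda _ fun n ↦ measurable_orbitMap hσ.measurable x₀ (q n))
  have hinj : Function.Injective fun x ↦ ((r, orbitMap H σ x₀ x ∘ q) : Slot X) := fun x y hxy ↦ by
    simpa [hn, orbitMap] using congrFun (Prod.ext_iff.1 hxy).2 n
  refine ⟨_, hmeas.measurableEmbedding hinj, fun x _ ↦ mk_comp_mem_fiber hqr _, fun h hh x hx ↦ ?_⟩
  rw [act_mk_comp hqr (hHK hh), ← funext (orbitMap_apply hσ x₀ hh hx)]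

end Label

end Slot

end Slots

theorem IsBorelActionOn.exists_image {G X E : Type*} [Group G] [MeasurableSpace X]
    [MeasurableSpace E] {K : Subgroup G} [Nonempty E] {b : G → E → E} {B : Set E}
    (hb : IsBorelActionOn K b B) {ι : E → X} (hι : MeasurableEmbedding ι) :
    ∃ a : G → X → X, IsBorelActionOn K a (ι '' B) ∧ ∀ k s, a k (ι s) = ι (b k s) := by
  obtain ⟨j, hj, hjι⟩ := hι.exists_measurable_extend measurable_id fun _ ↦ ‹Nonempty E›
  have hjι (s : E) : j (ι s) = s := congrFun hjι s
  refine ⟨fun k ↦ ι ∘ b k ∘ j, hb.conj hj hι.measurable ?_ (mapsTo_image ι B) ⟨?_, ?_⟩, ?_⟩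
  · rintro _ ⟨s, hs, rfl⟩
    rwa [hjι]
  · rintro _ ⟨s, -, rfl⟩
    rw [hjι]
  · exact fun s _ ↦ hjι s
  · simp only [Function.comp_apply, hjι, implies_true]

section PartialModels

variable {G X : Type*} [Group G] [MeasurableSpace X] {μ : Measure X} {η : G → X → X} {e : G → ℝ}
  {ι : Slot X → X} {H K : Subgroup G} {σ a b : G → X → X} {U : Set X}

/-- `σ` is an action of the subgroup `K` on the conull set `U` which models `η` and which, on the
slots free for `K`, embedded in `X` by `ι`, is the action on slots. -/
structure IsPartialModel (μ : Measure X) (η : G → X → X) (e : G → ℝ) (ι : Slot X → X)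
    (K : Subgroup G) (σ : G → X → X) (U : Set X) : Prop where
  action : IsBorelActionOn K σ U
  ae_mem : ∀ᵐ x ∂μ, x ∈ U
  ae_eq : ∀ k ∈ K, η k =ᵐ[μ] σ k
  slot_mem : MapsTo ι (Slot.free X e K) U
  slot : ∀ k ∈ K, ∀ s ∈ Slot.free X e K, σ k (ι s) = ι (Slot.act e k s)

theorem IsNearAction.exists_measurable_extension [StandardBorelSpace X] (hη : IsNearAction μ η)
    (hσ : IsPartialModel μ η e ι H σ univ) :
    ∃ F : G → X → X, (∀ g, Measurable (F g)) ∧ (∀ g, η g =ᵐ[μ] F g) ∧ ∀ h ∈ H, F h = σ h := by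
  have hF (g : G) : ∃ f : X → X, Measurable f ∧ η g =ᵐ[μ] f ∧ (g ∈ H → f = σ g) := by
    by_cases hg : g ∈ H
    · exact ⟨σ g, hσ.action.measurable g hg, hσ.ae_eq g hg, fun _ ↦ rfl⟩
    · exact ⟨_, (hη.aemeasurable g).measurable_mk, (hη.aemeasurable g).ae_eq_mk, (absurd · hg)⟩
  choose F hFm hηF hFσ using hF
  exact ⟨F, hFm, hηF, hFσ⟩

namespace IsPartialModel

open scoped Classical in
theorem exists_conull_extension [StandardBorelSpace X] [Nonempty X] (hη : IsNearAction μ η)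
    (hι : MeasurableEmbedding ι) (hμι : μ (range ι) = 0) [Countable K] (hHK : H ≤ K)
    (hσ : IsPartialModel μ η e ι H σ univ) :
    ∃ (a : G → X → X) (U : Set X), MeasurableSet U ∧ IsPartialModel μ η e ι K a U ∧
      (∀ h ∈ H, EqOn (a h) (σ h) U) ∧ ι ⁻¹' U ⊆ Slot.free X e K := by
  obtain ⟨F, hF, hηF, hFσ⟩ := hη.exists_measurable_extension hσ
  obtain ⟨b, hb, hbι⟩ := (Slot.isBorelActionOn_free (e := e) (H := K)).exists_image hι
  set X₀ := actionLocus K F (range ι)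
  have hX₀ : MeasurableSet X₀ :=
    measurableSet_actionLocus (fun k _ ↦ hF k) hι.measurableSet_range
  have hX₀_disj : Disjoint X₀ (range ι) := disjoint_actionLocus K F (range ι)
  have hX₀_ae : ∀ᵐ x ∂μ, x ∈ X₀ := hη.ae_mem_actionLocus (fun k _ ↦ hηF k) hμι
  have hιX₀ (s : Slot X) : ι s ∉ X₀ := hX₀_disj.notMem_of_mem_right (mem_range_self s)
  have haι (k : G) (s : Slot X) : X₀.piecewise (F k) (b k) (ι s) = ι (Slot.act e k s) :=
    (piecewise_eq_of_notMem _ _ _ (hιX₀ s)).trans (hbι k s)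
  refine ⟨fun k ↦ X₀.piecewise (F k) (b k), X₀ ∪ ι '' Slot.free X e K,
    hX₀.union (hι.measurableSet_image' Slot.measurableSet_free),
    { action := (isBorelActionOn_actionLocus (fun k _ ↦ hF k) _).piecewise hb hX₀
        (hX₀_disj.mono_right (image_subset_range _ _))
      ae_mem := hX₀_ae.mono fun _ ↦ .inl
      ae_eq := fun k _ ↦ ?_
      slot_mem := fun s hs ↦ .inr (mem_image_of_mem ι hs)
      slot := fun k _ s _ ↦ haι k s }, fun h hh ↦ ?_, fun s hs ↦ ?_⟩
  · filter_upwards [hX₀_ae, hηF k] with x hx hηFx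
    rw [hηFx, piecewise_eq_of_mem _ _ _ hx]
  · rintro x (hx | ⟨s, hs, rfl⟩)
    · simp only [piecewise_eq_of_mem _ _ _ hx, hFσ h hh]
    · simp only [haι, hσ.slot h hh s (Slot.free_anti hHK hs)]
  · exact (hι.injective.mem_set_image).1 (hs.resolve_left (hιX₀ s))

theorem exists_extension_on [StandardBorelSpace X] [Nonempty X] (he : e.Injective)
    (hι : MeasurableEmbedding ι) [Countable K] (hHK : H < K)
    (hσ : IsPartialModel μ η e ι H σ univ) {A : Set X} (hA : MeasurableSet A)
    (hσA : ∀ h ∈ H, MapsTo (σ h) A A) (hιA : ∀ s, s ∉ Slot.free X e K → ι s ∈ A) :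
    ∃ b : G → X → X, IsBorelActionOn K b A ∧ ∀ h ∈ H, EqOn (b h) (σ h) A := by
  obtain ⟨r, q, hq, hr, hqr⟩ := Slot.exists_mapCode he K
  have hσ_A : IsBorelActionOn H σ A := hσ.action.mono le_rfl (subset_univ A) hσA
  obtain ⟨f, hf, hfA, hfσ⟩ := Slot.exists_equivariant_mapsTo_fiber hq hqr hHK.le hσ_A
  refine hσ_A.exists_extension (Slot.isBorelActionOn_fiber r) hHK.le hA
    (Slot.measurableSet_fiber r) hf hfA hfσ hι (fun s hs ↦ hιA s ?_) fun h hh s hs ↦ ?_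
  · exact (Slot.disjoint_fiber_free hq hr).notMem_of_mem_left hs
  · exact (hσ.slot h hh s (Slot.fiber_subset_free he hq hr hHK hs)).symm

open scoped Classical in
theorem piecewise_univ (ha : IsPartialModel μ η e ι K a U) (hU : MeasurableSet U)
    (hb : IsBorelActionOn K b Uᶜ) :
    IsPartialModel μ η e ι K (fun k ↦ U.piecewise (a k) (b k)) univ where
  action := union_compl_self U ▸ ha.action.piecewise hb hU disjoint_compl_right
  ae_mem := .of_forall fun _ ↦ trivial
  ae_eq k hk := by
    filter_upwards [ha.ae_mem, ha.ae_eq k hk] with x hx hηa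
    rw [hηa, piecewise_eq_of_mem _ _ _ hx]
  slot_mem := mapsTo_univ _ _
  slot k hk s hs := (piecewise_eq_of_mem _ _ _ (ha.slot_mem hs)).trans (ha.slot k hk s hs)

open scoped Classical in
theorem exists_extension [StandardBorelSpace X] [Nonempty X] (hη : IsNearAction μ η)
    (he : e.Injective) (hι : MeasurableEmbedding ι) (hμι : μ (range ι) = 0) [Countable K]
    (hHK : H < K) (hσ : IsPartialModel μ η e ι H σ univ) :
    ∃ σ' : G → X → X, IsPartialModel μ η e ι K σ' univ ∧ ∀ h ∈ H, σ' h = σ h := by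
  obtain ⟨a, U, hU, ha, haσ, hιU⟩ := hσ.exists_conull_extension hη hι hμι hHK.le
  have hσU : ∀ h ∈ H, MapsTo (σ h) U U := fun h hh ↦
    (ha.action.mapsTo h (hHK.le hh)).congr (haσ h hh)
  have hσU_compl : ∀ h ∈ H, MapsTo (σ h) Uᶜ Uᶜ := compl_eq_univ_sdiff U ▸
    (hσ.action.diff hσU).mapsTo
  obtain ⟨b, hb, hbσ⟩ := hσ.exists_extension_on he hι hHK hU.compl hσU_compl
    fun s hs hsU ↦ hs (hιU hsU)
  refine ⟨_, ha.piecewise_univ hU hb, fun h hh ↦ funext fun x ↦ ?_⟩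
  by_cases hx : x ∈ U
  · exact (piecewise_eq_of_mem _ _ _ hx).trans (haσ h hh hx)
  · exact (piecewise_eq_of_notMem _ _ _ hx).trans (hbσ h hh hx)

theorem bot (hη : IsNearAction μ η) : IsPartialModel μ η e ι ⊥ (fun _ ↦ id) univ where
  action :=
    { measurable := fun _ _ ↦ measurable_id
      mapsTo := fun _ _ ↦ mapsTo_id _
      one := fun _ _ ↦ rfl
      mul := fun _ _ _ _ _ _ ↦ rfl }
  ae_mem := .of_forall fun _ ↦ trivial
  ae_eq k hk := Subgroup.mem_bot.1 hk ▸ hη.one_ae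
  slot_mem := mapsTo_univ _ _
  slot k hk s hs := by rw [Subgroup.mem_bot.1 hk, Slot.isBorelActionOn_free.one s hs, id]

theorem congr (hσ : IsPartialModel μ η e ι K σ U) {τ : G → X → X} (h : ∀ k ∈ K, τ k = σ k) :
    IsPartialModel μ η e ι K τ U where
  action := hσ.action.congr h
  ae_mem := hσ.ae_mem
  ae_eq k hk := h k hk ▸ hσ.ae_eq k hk
  slot_mem := hσ.slot_mem
  slot k hk := h k hk ▸ hσ.slot k hk

theorem sSup {c : Set (Subgroup G)} (hc : c.Nonempty) (hdir : DirectedOn (· ≤ ·) c)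
    (h : ∀ H ∈ c, IsPartialModel μ η e ι H σ univ) :
    IsPartialModel μ η e ι (sSup c) σ univ := by
  have hmem {g : G} : g ∈ SupSet.sSup c ↔ ∃ H ∈ c, g ∈ H := Subgroup.mem_sSup_of_directedOn hc hdir
  refine
    { action :=
        { measurable := fun k hk ↦ ?_
          mapsTo := fun _ _ ↦ mapsTo_univ _ _
          one := ?_
          mul := fun k hk l hl x hx ↦ ?_ }
      ae_mem := .of_forall fun _ ↦ trivial
      ae_eq := fun k hk ↦ ?_
      slot_mem := mapsTo_univ _ _
      slot := fun k hk s hs ↦ ?_ }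
  · obtain ⟨H, hHc, hkH⟩ := hmem.1 hk
    exact (h H hHc).action.measurable k hkH
  · obtain ⟨H, hHc⟩ := hc
    exact (h H hHc).action.one
  · obtain ⟨H, hHc, hkH⟩ := hmem.1 hk
    obtain ⟨J, hJc, hlJ⟩ := hmem.1 hl
    obtain ⟨L, hLc, hHL, hJL⟩ := hdir H hHc J hJc
    exact (h L hLc).action.mul k (hHL hkH) l (hJL hlJ) x hx
  · obtain ⟨H, hHc, hkH⟩ := hmem.1 hk
    exact (h H hHc).ae_eq k hkH
  · obtain ⟨H, hHc, hkH⟩ := hmem.1 hk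
    exact (h H hHc).slot k hkH s (Slot.free_anti (le_sSup hHc) hs)

end IsPartialModel

end PartialModels

section Transfinite

open Cardinal in
theorem exists_linearOrder_countable_Iio {α : Type*} (hα : #α ≤ ℵ_ 1) :
    ∃ _ : LinearOrder α, ∀ a : α, (Iio a).Countable := by
  obtain ⟨_, _, hα_ord⟩ := exists_ord_eq_type_lt α
  refine ⟨‹_›, fun a ↦ le_aleph0_iff_set_countable.1 ?_⟩
  rw [← Order.lt_succ_iff, succ_aleph0]
  exact (mk_Iio_lt a hα_ord).trans_le hα

variable {G α : Type*}

theorem exists_eqOn_of_compatible {ι : Type*} {c : Set ι} (hc : c.Nonempty) (s : ι → Set G)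
    (f : ι → G → α) (h : ∀ i ∈ c, ∀ j ∈ c, ∀ g ∈ s i, g ∈ s j → f i g = f j g) :
    ∃ F : G → α, ∀ i ∈ c, EqOn F (f i) (s i) := by
  have hvalue (g : G) : ∃ y, ∀ i ∈ c, g ∈ s i → y = f i g := by
    by_cases hg : ∃ i ∈ c, g ∈ s i
    · obtain ⟨i, hi, hgi⟩ := hg
      exact ⟨f i g, fun j hj hgj ↦ h i hi j hj g hgi hgj⟩
    · push Not at hg
      exact ⟨f hc.some g, fun i hi hgi ↦ absurd hgi (hg i hi)⟩
  choose F hF using hvalue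
  exact ⟨F, fun i hi g hg ↦ hF g i hi hg⟩

variable [Group G]

theorem countable_closure {s : Set G} (hs : s.Countable) : Countable (Subgroup.closure s) := by
  have := hs.to_subtype
  rw [FreeGroup.closure_eq_range]
  exact (FreeGroup.lift _).rangeRestrict_surjective.countable

/-- The relation `P H σ`, which says that `σ` is a solution on the subgroup `H`, admits solutions on
the trivial subgroup, is local, passes to directed unions, and solutions extend from a subgroup to
any countable larger one. -/
structure IsExtensionProblem (P : Subgroup G → (G → α) → Prop) : Prop where
  exists_bot : ∃ σ, P ⊥ σ
  congr : ∀ ⦃H σ τ⦄, P H σ → EqOn τ σ H → P H τ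
  sSup : ∀ ⦃c : Set (Subgroup G)⦄ ⦃σ⦄, c.Nonempty → DirectedOn (· ≤ ·) c →
    (∀ H ∈ c, P H σ) → P (sSup c) σ
  extend : ∀ ⦃H K : Subgroup G⦄ ⦃σ⦄, Countable K → H < K → P H σ → ∃ τ, P K τ ∧ EqOn τ σ H

/-- A solution of an extension problem on the subgroup generated by an initial segment. -/
structure InitialSolution [LE G] (P : Subgroup G → (G → α) → Prop) where
  segment : LowerSet G
  map : G → α
  isSolution : P (Subgroup.closure segment) map

namespace InitialSolution

variable {P : Subgroup G → (G → α) → Prop}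

/-- The subgroup on which an initial solution solves its problem. -/
def closure [LE G] (p : InitialSolution P) : Subgroup G :=
  Subgroup.closure p.segment

/-- The order of the transfinite construction: a larger segment, and the same values wherever `p`
is a solution. -/
def Extends [LE G] (q p : InitialSolution P) : Prop :=
  p.segment ≤ q.segment ∧ EqOn q.map p.map p.closure

theorem Extends.trans [LE G] {p q s : InitialSolution P} (hsq : s.Extends q) (hqp : q.Extends p) :
    s.Extends p :=
  ⟨hqp.1.trans hsq.1, fun _g hg ↦ (hsq.2 (Subgroup.closure_mono hqp.1 hg)).trans (hqp.2 hg)⟩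

theorem exists_extends_of_isChain [LE G] (hP : IsExtensionProblem P) {c : Set (InitialSolution P)}
    (hc : IsChain (fun p q ↦ q.Extends p) c) (hne : c.Nonempty) :
    ∃ q : InitialSolution P, ∀ p ∈ c, q.Extends p := by
  have hcompat : ∀ p ∈ c, ∀ q ∈ c, ∀ g ∈ p.closure, g ∈ q.closure → p.map g = q.map g := by
    intro p hp q hq g hgp hgq
    rcases eq_or_ne p q with rfl | hpq
    · rfl
    · exact (hc hp hq hpq).elim (fun h ↦ (h.2 hgp).symm) fun h ↦ h.2 hgq
  obtain ⟨σ, hσ⟩ := exists_eqOn_of_compatible hne (fun p ↦ (p.closure : Set G)) map hcompat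
  have hdir : DirectedOn (· ≤ ·) (closure '' c) :=
    (hc.image_of_map_rel _ (· ≤ ·) closure fun _ _ h ↦ Subgroup.closure_mono h.1).directedOn
  have hclosure : Subgroup.closure ((⨆ p ∈ c, p.segment : LowerSet G) : Set G) =
      sSup (closure '' c) := by
    simp only [LowerSet.coe_iSup₂, Subgroup.closure_iUnion, sSup_image, closure]
  have hsol : P (sSup (closure '' c)) σ := by
    refine hP.sSup (hne.image _) hdir ?_
    rintro _ ⟨p, hp, rfl⟩
    exact hP.congr p.isSolution (hσ p hp)
  exact ⟨⟨_, σ, hclosure ▸ hsol⟩, fun p hp ↦ ⟨le_iSup₂_of_le p hp le_rfl, hσ p hp⟩⟩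

theorem exists_extends_of_notMem [LinearOrder G] (hG : ∀ g : G, (Iio g).Countable)
    (hP : IsExtensionProblem P) (p : InitialSolution P) {g : G} (hg : g ∉ p.segment) :
    ∃ q : InitialSolution P, q.Extends p ∧ g ∈ q.segment := by
  have hle : p.segment ≤ LowerSet.Iic g := fun x hx ↦
    le_of_not_ge fun hgx ↦ hg (p.segment.lower hgx hx)
  have hIic : (Iic g).Countable := Iio_insert (a := g) ▸ (hG g).insert g
  have : Countable (Subgroup.closure (LowerSet.Iic g : Set G)) := countable_closure hIic
  rcases (Subgroup.closure_mono hle).eq_or_lt with heq | hlt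
  · exact ⟨⟨LowerSet.Iic g, p.map, heq ▸ p.isSolution⟩, ⟨hle, fun _ _ ↦ rfl⟩, le_rfl⟩
  · obtain ⟨τ, hτ, hτp⟩ := hP.extend this hlt p.isSolution
    exact ⟨⟨LowerSet.Iic g, τ, hτ⟩, ⟨hle, hτp⟩, le_rfl⟩

end InitialSolution

open Cardinal in
theorem IsExtensionProblem.exists_top {P : Subgroup G → (G → α) → Prop}
    (hP : IsExtensionProblem P) (hG : #G ≤ ℵ_ 1) : ∃ σ, P ⊤ σ := by
  obtain ⟨_, hIio⟩ := exists_linearOrder_countable_Iio hG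
  have : Nonempty (InitialSolution P) := by
    obtain ⟨σ, hσ⟩ := hP.exists_bot
    exact ⟨⊥, σ, by simpa using hσ⟩
  obtain ⟨p, hp⟩ := exists_maximal_of_nonempty_chains_bounded
    (fun _c hc hne ↦ InitialSolution.exists_extends_of_isChain hP hc hne)
    fun hqp hsq ↦ hsq.trans hqp
  have hp_top : p.segment = ⊤ := by
    by_contra hne
    obtain ⟨g, hg⟩ : ∃ g, g ∉ p.segment := by
      by_contra! hall
      exact hne (SetLike.ext fun g ↦ ⟨fun _ ↦ trivial, fun _ ↦ hall g⟩)
    obtain ⟨q, hqp, hgq⟩ := p.exists_extends_of_notMem hIio hP hg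
    exact hg ((hp q hqp).1 hgq)
  exact ⟨p.map, by simpa [hp_top] using p.isSolution⟩

end Transfinite

section Kernel

variable {G X : Type*} [Group G] [MeasurableSpace X] {μ : Measure X} {η : G → X → X}

namespace IsNearAction

/-- The subgroup of elements acting trivially almost everywhere, the kernel of the homomorphism
from `G` to the group of maps modulo almost everywhere equality. -/
def kernel (hη : IsNearAction μ η) : Subgroup G where
  carrier := {g | ∀ᵐ x ∂μ, η g x = x}
  one_mem' := hη.one_ae
  mul_mem' {g h} hg hh := by
    change ∀ᵐ x ∂μ, η (g * h) x = x
    filter_upwards [hη.mul_ae g h, hg, hh] with x hgh hg hh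
    rw [hgh, hh, hg]
  inv_mem' {g} hg := by
    change ∀ᵐ x ∂μ, η g⁻¹ x = x
    filter_upwards [hη.inv_apply_ae g, hg] with x hinv hg
    rwa [hg] at hinv

theorem mem_kernel (hη : IsNearAction μ η) {g : G} : g ∈ hη.kernel ↔ ∀ᵐ x ∂μ, η g x = x :=
  Iff.rfl

instance kernel_normal (hη : IsNearAction μ η) : hη.kernel.Normal where
  conj_mem n hn g := by
    rw [mem_kernel] at hn ⊢
    filter_upwards [hη.mul_ae (g * n) g⁻¹, (hη.tendsto_ae g⁻¹).eventually (hη.mul_ae g n),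
      (hη.tendsto_ae g⁻¹).eventually hn, hη.apply_inv_ae g] with x hgn hmul hn hinv
    rw [hgn, hmul, hn, hinv]

theorem mk_eq_mk_iff (hη : IsNearAction μ η) {g h : G} :
    (g : G ⧸ hη.kernel) = h ↔ ∀ᵐ x ∂μ, η g x = η h x := by
  rw [QuotientGroup.eq, mem_kernel]
  constructor
  · intro hgh
    filter_upwards [hη.mul_ae g (g⁻¹ * h), hgh] with x hmul hgh
    rw [mul_inv_cancel_left, hgh] at hmul
    exact hmul.symm
  · intro hgh
    filter_upwards [hη.mul_ae g⁻¹ h, hgh, hη.inv_apply_ae g] with x hmul hgh hinv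
    rw [hmul, ← hgh, hinv]

theorem out_mk_ae (hη : IsNearAction μ η) (g : G) :
    ∀ᵐ x ∂μ, η (g : G ⧸ hη.kernel).out x = η g x :=
  hη.mk_eq_mk_iff.1 (QuotientGroup.out_eq' _)

theorem quotient (hη : IsNearAction μ η) :
    IsNearAction μ fun q : G ⧸ hη.kernel ↦ η q.out where
  one_ae := by
    filter_upwards [hη.out_mk_ae 1, hη.one_ae] with x hout hone
    exact hout.trans hone
  mul_ae p q := by
    have hout := hη.out_mk_ae (p.out * q.out)
    rw [QuotientGroup.mk_mul, QuotientGroup.out_eq', QuotientGroup.out_eq'] at hout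
    filter_upwards [hout, hη.mul_ae p.out q.out] with x hout hmul
    rw [hout, hmul]
  preserves q := hη.preserves q.out

end IsNearAction

theorem IsSpatialModel.of_quotient {hη : IsNearAction μ η} {ρ : G ⧸ hη.kernel → X → X}
    (hρ : IsSpatialModel μ (fun q : G ⧸ hη.kernel ↦ η q.out) ρ) :
    IsSpatialModel μ η fun g ↦ ρ g where
  isSpatialAction :=
    { one := hρ.isSpatialAction.one
      mul := fun g h ↦ hρ.isSpatialAction.mul g h
      preserves := fun g ↦ hρ.isSpatialAction.preserves g }
  ae_eq g := by
    filter_upwards [hη.out_mk_ae g, hρ.ae_eq g] with x hout hρ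
    rw [← hout, hρ]

end Kernel

section Cardinality

open Cardinal

theorem exists_injective_real_of_mk_le_continuum {α : Type u} (hα : #α ≤ 𝔠) :
    ∃ e : α → ℝ, e.Injective := by
  have hcard : lift.{0} #α ≤ lift.{u} #ℝ := by simpa [mk_real] using hα
  obtain ⟨e⟩ := lift_mk_le'.1 hcard
  exact ⟨e, e.injective⟩

theorem mk_measurableSet_le_continuum (X : Type u) [MeasurableSpace X]
    [MeasurableSpace.CountablyGenerated X] : #{s : Set X // MeasurableSet s} ≤ 𝔠 := by
  obtain ⟨b, hb, hgen⟩ := MeasurableSpace.CountablyGenerated.isCountablyGenerated (α := X)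
  rw [hgen]
  exact MeasurableSpace.cardinal_measurableSet_le_continuum
    ((le_aleph0_iff_set_countable.2 hb).trans aleph0_le_continuum)

theorem mk_measurable_le_continuum (X : Type u) [MeasurableSpace X]
    [MeasurableSpace.CountablyGenerated X] [MeasurableSpace.SeparatesPoints X] :
    #{f : X → X // Measurable f} ≤ 𝔠 := by
  obtain ⟨φ, hφ, hφ_inj⟩ := MeasurableSpace.measurable_injection_nat_bool_of_countablySeparated X
  let Φ (f : {f : X → X // Measurable f}) (n : ℕ) : {s : Set X // MeasurableSet s} :=
    ⟨{x | φ (f.1 x) n = true},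
      ((measurable_pi_apply n).comp (hφ.comp f.2)) (measurableSet_singleton true)⟩
  have hΦ : Φ.Injective := fun f f' hff' ↦ Subtype.ext <| funext fun x ↦ hφ_inj <| funext fun n ↦
    Bool.eq_iff_iff.2 (Set.ext_iff.1 (Subtype.ext_iff.1 (congrFun hff' n)) x)
  calc #{f : X → X // Measurable f}
      ≤ #(ℕ → {s : Set X // MeasurableSet s}) := mk_le_of_injective hΦ
    _ ≤ 𝔠 ^ ℵ₀ := by
      rw [mk_arrow, mk_nat, lift_aleph0, lift_uzero]
      exact power_le_power_right (mk_measurableSet_le_continuum X)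
    _ = 𝔠 := continuum_power_aleph0

theorem IsNearAction.lift_mk_quotient_kernel_le {G : Type v} {X : Type u} [Group G]
    [MeasurableSpace X] [StandardBorelSpace X] {μ : Measure X} {η : G → X → X}
    (hη : IsNearAction μ η) : lift.{u} #(G ⧸ hη.kernel) ≤ 𝔠 := by
  let Φ (q : G ⧸ hη.kernel) : {f : X → X // Measurable f} :=
    ⟨(hη.aemeasurable q.out).mk _, (hη.aemeasurable q.out).measurable_mk⟩
  have hΦ : Φ.Injective := by
    intro p q hpq
    rw [← QuotientGroup.out_eq' p, ← QuotientGroup.out_eq' q, hη.mk_eq_mk_iff]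
    filter_upwards [(hη.aemeasurable p.out).ae_eq_mk, (hη.aemeasurable q.out).ae_eq_mk]
      with x hp hq
    rw [hp, hq]
    exact congrFun (Subtype.ext_iff.1 hpq) x
  calc lift.{u} #(G ⧸ hη.kernel)
      ≤ lift.{v} #{f : X → X // Measurable f} := lift_mk_le'.2 ⟨⟨Φ, hΦ⟩⟩
    _ ≤ lift.{v} 𝔠 := Cardinal.lift_le.2 (mk_measurable_le_continuum X)
    _ = 𝔠 := lift_continuum

theorem IsNearAction.mk_quotient_kernel_le_aleph_one {G : Type v} {X : Type u} [Group G]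
    [MeasurableSpace X] [StandardBorelSpace X] {μ : Measure X} {η : G → X → X}
    (hη : IsNearAction μ η) (hCH : 𝔠 = aleph.{0} 1) : #(G ⧸ hη.kernel) ≤ aleph 1 := by
  have hCH' : continuum.{max u v} = aleph 1 := by simpa using congrArg lift.{max u v} hCH
  rw [← Cardinal.lift_le.{u}, lift_aleph, Ordinal.lift_one, ← hCH']
  exact hη.lift_mk_quotient_kernel_le

end Cardinality

section NullSets

variable {X : Type*} [MeasurableSpace X] [StandardBorelSpace X]

theorem exists_uncountable_null_set [Uncountable X] (μ : Measure X) [SFinite μ] :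
    ∃ N : Set X, MeasurableSet N ∧ ¬ N.Countable ∧ μ N = 0 := by
  let φ : X ≃ᵐ ℝ × ℝ := PolishSpace.measurableEquivOfNotCountable not_countable not_countable
  let fiber (r : ℝ) : Set X := {x | (φ x).1 = r}
  have hmeas (r : ℝ) : MeasurableSet (fiber r) :=
    measurableSet_eq_fun (measurable_fst.comp φ.measurable) measurable_const
  have hdisj : Pairwise (Function.onFun Disjoint fiber) := fun r s hrs ↦
    disjoint_left.2 fun x hr hs ↦ hrs (Eq.trans (Eq.symm hr) hs)
  have hpos : {r | 0 < μ (fiber r)}.Countable :=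
    Measure.countable_meas_pos_of_disjoint_iUnion hmeas hdisj
  obtain ⟨r, hr⟩ : {r | 0 < μ (fiber r)}ᶜ.Nonempty :=
    nonempty_compl.2 fun huniv ↦ not_countable_univ (huniv ▸ hpos)
  have hinj : Function.Injective fun s ↦ φ.symm (r, s) :=
    φ.symm.injective.comp (Prod.mk_right_injective r)
  refine ⟨fiber r, hmeas r, fun hc ↦ not_countable_univ (α := ℝ) ?_, by simpa using hr⟩
  refine (hc.preimage hinj).mono fun s _ ↦ ?_
  simp [fiber]

theorem exists_measurableEmbedding_null_range {μ : Measure X} {N : Set X} (hN : ¬ N.Countable)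
    (hμN : μ N = 0) (Y : Type*) [MeasurableSpace Y] [StandardBorelSpace Y] :
    ∃ ι : Y → X, MeasurableEmbedding ι ∧ μ (range ι) = 0 := by
  have hM : MeasurableSet (toMeasurable μ N) := measurableSet_toMeasurable μ N
  have := hM.standardBorel
  have hM_unc : ¬ Countable (toMeasurable μ N) := fun h ↦
    hN ((countable_coe_iff.1 h).mono (subset_toMeasurable μ N))
  obtain ⟨j, hj⟩ := exists_measurableEmbedding_real Y
  let φ : ℝ ≃ᵐ toMeasurable μ N := PolishSpace.measurableEquivOfNotCountable not_countable hM_unc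
  refine ⟨fun y ↦ φ (j y),
    (MeasurableEmbedding.subtype_coe hM).comp (φ.measurableEmbedding.comp hj), ?_⟩
  exact measure_mono_null (range_subset_iff.2 fun y ↦ (φ (j y)).2) (by rwa [measure_toMeasurable])

end NullSets

section SpatialModels

variable {G : Type v} {X : Type u} [Group G] [MeasurableSpace X] [StandardBorelSpace X]
  {μ : Measure X} {η : G → X → X}

theorem IsPartialModel.isExtensionProblem [Nonempty X] (hη : IsNearAction μ η) {e : G → ℝ}
    (he : e.Injective) {ι : Slot X → X} (hι : MeasurableEmbedding ι) (hμι : μ (range ι) = 0) :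
    IsExtensionProblem fun K σ ↦ IsPartialModel μ η e ι K σ univ where
  exists_bot := ⟨_, bot hη⟩
  congr _ _ _ hσ h := hσ.congr h
  sSup _ _ := sSup
  extend _ _ _ _ hHK hσ := hσ.exists_extension hη he hι hμι hHK

theorem IsNearAction.exists_isSpatialModel_of_mk_le_aleph_one {N : Set X} (hN : ¬ N.Countable)
    (hμN : μ N = 0) (hη : IsNearAction μ η) (hG : Cardinal.mk G ≤ Cardinal.aleph 1) :
    ∃ ρ : G → X → X, IsSpatialModel μ η ρ ∧ ActsByBorelAutomorphisms ρ := by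
  have : Nonempty X := not_isEmpty_iff.1 fun _ ↦ hN N.to_countable
  obtain ⟨e, he⟩ := exists_injective_real_of_mk_le_continuum
    (hG.trans Cardinal.aleph_one_le_continuum)
  obtain ⟨ι, hι, hμι⟩ := exists_measurableEmbedding_null_range hN hμN (Slot X)
  obtain ⟨ρ, hρ⟩ := (IsPartialModel.isExtensionProblem hη he hι hμι).exists_top hG
  exact ⟨ρ, hη.isSpatialModel hρ.action fun g ↦ hρ.ae_eq g trivial,
    fun g ↦ ⟨hρ.action.measurableEquiv g, fun _ ↦ rfl⟩⟩

theorem mainTheorem4_general {N : Set X} (hN : ¬ N.Countable) (hμN : μ N = 0)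
    (hη : IsNearAction μ η) (hG : Cardinal.mk (G ⧸ hη.kernel) ≤ Cardinal.aleph 1) :
    ∃ ρ : G → X → X, IsSpatialModel μ η ρ ∧ ActsByBorelAutomorphisms ρ := by
  obtain ⟨ρ, hρ, hρ_borel⟩ := hη.quotient.exists_isSpatialModel_of_mk_le_aleph_one hN hμN hG
  exact ⟨fun g ↦ ρ g, hρ.of_quotient, fun g ↦ hρ_borel g⟩

end SpatialModels

theorem mainTheorem4 {X : Type u} [MeasurableSpace X] [StandardBorelSpace X]
    (μ : Measure X) :
    (Uncountable X → SigmaFinite μ →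
      ∃ N : Set X, MeasurableSet N ∧ ¬ N.Countable ∧ μ N = 0) ∧
    ((∃ N : Set X, ¬ N.Countable ∧ μ N = 0) →
      (∀ (G : Type v) [Group G], Cardinal.mk G ≤ Cardinal.aleph 1 →
        ∀ η : G → X → X, IsNearAction μ η →
          ∃ ρ : G → X → X, IsSpatialModel μ η ρ ∧ ActsByBorelAutomorphisms ρ) ∧
      (Cardinal.continuum.{0} = Cardinal.aleph 1 →
        ∀ (G : Type v) [Group G],
        ∀ η : G → X → X, IsNearAction μ η →
          ∃ ρ : G → X → X, IsSpatialModel μ η ρ ∧ ActsByBorelAutomorphisms ρ)) := by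
  refine ⟨fun _ _ ↦ exists_uncountable_null_set μ, ?_⟩
  rintro ⟨N, hN, hμN⟩
  refine ⟨fun G _ hG η hη ↦ ?_, fun hCH G _ η hη ↦ ?_⟩
  · exact mainTheorem4_general hN hμN hη (Cardinal.mk_quotient_le.trans hG)
  · exact mainTheorem4_general hN hμN hη (hη.mk_quotient_kernel_le_aleph_one hCH)
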